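/- Let $G$ be a countable discrete group, let $f=\sum_{g\in G}f_g\,g\in\mathbb{R}(G)$ (the real group ring) and let $S=\{g\in G\setminus\{1\}: f_g\neq 0\}$. Suppose that $f$ is semi-lopsided, i.e. $f_1>0$ and $\sum_{g\neq 1}|f_g|\le f_1$, and that the subgroup generated by $(S\cup S^{-1})^2=\{ab: a,b\in S\cup S^{-1}\}$ is infinite. Let $H=\langle S\rangle$. For $p\in\{1,2\}$, an $\ell^p$ formal inverse of $f$ is a function $\xi\in\ell^p(G,\mathbb{R})$ with $\xi f=f\xi=\delta_1$, where $(f\xi)(g)=\sum_{h}f_h\,\xi(h^{-1}g)$ and $(\xi f)(g)=\sum_h \xi(gh^{-1})f_h$. (i) If $f$ is lopsided, i.e. $\sum_{g\neq 1}|f_g|<f_1$, then $f$ has an $\ell^1$ formal inverse. (ii) If $f$ is not lopsided, and $H$ has either superpolynomial growth or polynomial growth of some degree $d\geq 5$, then $f$ has an $\ell^2$ formal inverse. Here, for a finite generating set $T$ of $H$, let $\gamma_T(n)$ be the number of elements of $H$ that are products of at most $n$ elements of $T\cup T^{-1}$. The group $H$ has superpolynomial growth if for some (equivalently, every) such $T$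 one has $\gamma_T(n)/n^k\to\infty$ as $n\to\infty$ for every $k\in\mathbb{N}$; it has polynomial growth of degree $d\in\mathbb{N}$ if for some (equivalently, every) such $T$ there are constants $c,C>0$ with $c\,n^d\le\gamma_T(n)\le C\,n^d$ for all $n\ge 1$. -/

import Mathlib

open scoped Pointwise ENNReal

noncomputable section

namespace GroupRing

variable {G : Type*} [Group G]

/-- The set `S` of non-identity elements of the group at which `f` has a nonzero coefficient. -/
def offSupport (f : MonoidAlgebra ℝ G) : Set G := {g | f.coeff g ≠ 0 ∧ g ≠ 1}

open Classical in
/-- The sum of the absolute values of the coefficients of `f` at the non-identity elements. -/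
def offNorm (f : MonoidAlgebra ℝ G) : ℝ := ∑ g ∈ f.coeff.support.erase 1, |f.coeff g|

/-- `f` is semi-lopsided: `f₁ > 0` and `∑_{g ≠ 1} |f_g| ≤ f₁`. -/
def IsSemiLopsided (f : MonoidAlgebra ℝ G) : Prop := 0 < f.coeff 1 ∧ offNorm f ≤ f.coeff 1

/-- `f` is lopsided: `∑_{g ≠ 1} |f_g| < f₁`. -/
def IsLopsided (f : MonoidAlgebra ℝ G) : Prop := offNorm f < f.coeff 1

/-- Left convolution of a real function by a group ring element:
`(f ξ)(g) = ∑_h f_h ξ(h⁻¹ g)`. -/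
def convLeft (f : MonoidAlgebra ℝ G) (ξ : G → ℝ) : G → ℝ :=
  fun g => ∑ h ∈ f.coeff.support, f.coeff h * ξ (h⁻¹ * g)

/-- Right convolution of a real function by a group ring element:
`(ξ f)(g) = ∑_h ξ(g h⁻¹) f_h`. -/
def convRight (ξ : G → ℝ) (f : MonoidAlgebra ℝ G) : G → ℝ :=
  fun g => ∑ h ∈ f.coeff.support, ξ (g * h⁻¹) * f.coeff h

open Classical in
/-- The indicator function of the identity element. -/
def deltaOne : G → ℝ := fun g => if g = 1 then 1 else 0

/-- `f` has an `ℓᵖ` formal inverse: a function `ξ ∈ ℓᵖ(G, ℝ)` with `ξ f = δ₁` and `f ξ = δ₁`. -/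
def HasLpFormalInverse (p : ℝ≥0∞) (f : MonoidAlgebra ℝ G) : Prop :=
  ∃ ξ : G → ℝ, Memℓp ξ p ∧ convRight ξ f = deltaOne ∧ convLeft f ξ = deltaOne

end GroupRing

namespace GroupGrowth

/-- The growth function of a group with respect to `T`: the number of group elements which are
products of at most `n` factors from `T ∪ T⁻¹`. -/
def growth {H : Type*} [Group H] (T : Set H) (n : ℕ) : ℕ :=
  ((insert 1 (T ∪ T⁻¹) : Set H) ^ n).ncard

/-- `H` has superpolynomial growth: with respect to some (equivalently, any) finite generating
set, the growth function grows faster than every polynomial. -/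
def HasSuperpolynomialGrowth (H : Type*) [Group H] : Prop :=
  ∃ T : Set H, T.Finite ∧ Subgroup.closure T = ⊤ ∧
    ∀ d : ℕ, Filter.Tendsto (fun n : ℕ => (growth T n : ℝ) / (n : ℝ) ^ d) Filter.atTop Filter.atTop

/-- `H` has polynomial growth of degree `d`: with respect to some (equivalently, any) finite
generating set, the growth function lies between positive multiples of `n ^ d`. -/
def HasPolynomialGrowthOfDegree (H : Type*) [Group H] (d : ℕ) : Prop :=
  ∃ T : Set H, T.Finite ∧ Subgroup.closure T = ⊤ ∧
    ∃ c C : ℝ, 0 < c ∧ 0 < C ∧ ∀ n : ℕ, 1 ≤ n →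
      c * (n : ℝ) ^ d ≤ (growth T n : ℝ) ∧ (growth T n : ℝ) ≤ C * (n : ℝ) ^ d

end GroupGrowth

end

/-! Write `f = 2 f₁ (1 - b)`, so that `b` has coefficient `1/2` at the identity, and invert `f` by
the Neumann series `∑ bⁿ`. If `f` is lopsided, `b` has `ℓ¹` norm below `1` and the series is
geometric. Otherwise `ν = |b|` is a lazy probability measure dominating `b`, and it suffices that `∑
‖νⁿ‖₂ < ∞`. Put `w n = ‖νⁿ‖₂`. Laziness bounds the squared displacement of `νⁿ` under generators by
a multiple of `w n ^ 2 - w (n + 1) ^ 2` (`translationDist_sq_le`). Averaging over a ball of `H` of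
radius `r`, with at least `c r⁵` elements, gives the Nash type bound `w n ≤ L r M + (c r⁵)^(-1/2)`
(`exists_norm_toLp_two_le`), where `M` bounds the displacement. With `w = z⁵` and `r` of order `z⁻²`
this becomes `w n ≤ C (z n - z (n + 1))` (`le_mul_sub_of_forall_radius`), which telescopes. -/

namespace GroupRing

/-! ### Norms and convolution in the group ring; Neumann series. -/

variable {G : Type*}

/-- An element of the group ring, viewed as an element of `ℓᵖ(G)`. -/
def toLp (p : ℝ≥0∞) [Fact (1 ≤ p)] : MonoidAlgebra ℝ G →ₗ[ℝ] lp (fun _ : G => ℝ) p where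
  toFun x := ⟨fun g => x.coeff g,
    (memℓp_zero x.coeff.hasFiniteSupport).of_exponent_ge (zero_le)⟩
  map_add' _ _ := rfl
  map_smul' _ _ := rfl

theorem toLp_apply (p : ℝ≥0∞) [Fact (1 ≤ p)] (x : MonoidAlgebra ℝ G) (g : G) :
    toLp p x g = x.coeff g := rfl

/-- The sum of the absolute values of the coefficients. -/
def absSum (x : MonoidAlgebra ℝ G) : ℝ := ∑ g ∈ x.coeff.support, |x.coeff g|

theorem absSum_nonneg (x : MonoidAlgebra ℝ G) : 0 ≤ absSum x :=
  Finset.sum_nonneg fun _ _ => abs_nonneg _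

theorem norm_toLp_one (x : MonoidAlgebra ℝ G) : ‖toLp 1 x‖ = absSum x := by
  rw [lp.norm_eq_tsum_rpow (by simp)]
  simp only [toLp_apply, ENNReal.toReal_one, Real.rpow_one, div_one, Real.norm_eq_abs]
  exact tsum_eq_sum fun g hg => by simpa using hg

theorem norm_toLp_two_sq (x : MonoidAlgebra ℝ G) :
    ‖toLp 2 x‖ ^ 2 = ∑ g ∈ x.coeff.support, x.coeff g ^ 2 := by
  have h := lp.norm_rpow_eq_tsum (p := 2) (by simp) (toLp 2 x)
  simp only [toLp_apply, ENNReal.toReal_ofNat, Real.rpow_two, Real.norm_eq_abs, sq_abs] at h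
  rw [h]
  exact tsum_eq_sum fun g hg => by simpa using hg

theorem norm_toLp_two_sq_le {x : MonoidAlgebra ℝ G} {C : ℝ} (hC : ∀ g, |x.coeff g| ≤ C) :
    ‖toLp 2 x‖ ^ 2 ≤ C * absSum x := by
  rw [norm_toLp_two_sq, absSum, Finset.mul_sum]
  refine Finset.sum_le_sum fun g _ => ?_
  rw [← sq_abs, sq]
  exact mul_le_mul_of_nonneg_right (hC g) (abs_nonneg _)

theorem sum_abs_le_absSum (x : MonoidAlgebra ℝ G) (s : Finset G) :
    ∑ g ∈ s, |x.coeff g| ≤ absSum x := by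
  classical
  have h : ∑ g ∈ s, |x.coeff g| = ∑ g ∈ s ∩ x.coeff.support, |x.coeff g| := by
    refine (Finset.sum_subset Finset.inter_subset_left fun g hg hg' => ?_).symm
    simpa [hg] using hg'
  rw [h]
  exact Finset.sum_le_sum_of_subset_of_nonneg Finset.inter_subset_right
    fun _ _ _ => abs_nonneg _

theorem norm_toLp_mono {p : ℝ≥0∞} [Fact (1 ≤ p)] {x y : MonoidAlgebra ℝ G}
    (h : ∀ g, |x.coeff g| ≤ y.coeff g) : ‖toLp p x‖ ≤ ‖toLp p y‖ := by
  refine lp.norm_mono (zero_lt_one.trans_le Fact.out).ne' fun g => ?_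
  simpa [toLp_apply] using (h g).trans (le_abs_self _)

variable [Group G]

theorem norm_toLp_single_mul {p : ℝ≥0∞} [Fact (1 ≤ p)] (hp : 0 < p.toReal) (h : G)
    (x : MonoidAlgebra ℝ G) : ‖toLp p (MonoidAlgebra.single h 1 * x)‖ = ‖toLp p x‖ := by
  rw [lp.norm_eq_tsum_rpow hp, lp.norm_eq_tsum_rpow hp]
  simp only [toLp_apply, MonoidAlgebra.coeff_single_mul_apply, one_mul]
  rw [← (Equiv.mulLeft h⁻¹).tsum_eq fun g => ‖x.coeff g‖ ^ p.toReal]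
  rfl

theorem mul_eq_sum_smul (x y : MonoidAlgebra ℝ G) :
    x * y = ∑ h ∈ x.coeff.support, x.coeff h • (MonoidAlgebra.single h 1 * y) := by
  ext g
  rw [MonoidAlgebra.coeff_mul_apply_left, MonoidAlgebra.coeff_sum, Finsupp.finsetSum_apply]
  simp [Finsupp.sum]

theorem norm_toLp_mul_le {p : ℝ≥0∞} [Fact (1 ≤ p)] (hp : 0 < p.toReal)
    (x y : MonoidAlgebra ℝ G) : ‖toLp p (x * y)‖ ≤ absSum x * ‖toLp p y‖ := by
  rw [mul_eq_sum_smul, map_sum, absSum, Finset.sum_mul]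
  refine (norm_sum_le _ _).trans (Finset.sum_le_sum fun h _ => ?_)
  rw [map_smul, norm_smul, norm_toLp_single_mul hp, Real.norm_eq_abs]

theorem absSum_mul_le (x y : MonoidAlgebra ℝ G) : absSum (x * y) ≤ absSum x * absSum y := by
  simpa [norm_toLp_one] using norm_toLp_mul_le (p := 1) (by simp) x y

theorem absSum_one : absSum (1 : MonoidAlgebra ℝ G) = 1 := by
  simp [absSum, MonoidAlgebra.one_def]

theorem absSum_pow_le (x : MonoidAlgebra ℝ G) (n : ℕ) : absSum (x ^ n) ≤ absSum x ^ n := by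
  induction n with
  | zero => simp [absSum_one]
  | succ n ih =>
    rw [pow_succ', pow_succ']
    exact (absSum_mul_le _ _).trans (mul_le_mul_of_nonneg_left ih (absSum_nonneg x))

theorem coeff_mul_eq_sum {x y : MonoidAlgebra ℝ G} {s : Finset G} (hs : x.coeff.support ⊆ s)
    (g : G) : (x * y).coeff g = ∑ h ∈ s, x.coeff h * y.coeff (h⁻¹ * g) := by
  rw [MonoidAlgebra.coeff_mul_apply_left]
  exact Finsupp.sum_of_support_subset _ hs _ (by simp)

theorem abs_coeff_mul_le {x x' y y' : MonoidAlgebra ℝ G} (hx : ∀ g, |x.coeff g| ≤ x'.coeff g)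
    (hy : ∀ g, |y.coeff g| ≤ y'.coeff g) (g : G) : |(x * y).coeff g| ≤ (x' * y').coeff g := by
  classical
  rw [coeff_mul_eq_sum (Finset.subset_union_left (s₂ := x'.coeff.support)),
    coeff_mul_eq_sum (Finset.subset_union_right (s₁ := x.coeff.support))]
  refine (Finset.abs_sum_le_sum_abs _ _).trans (Finset.sum_le_sum fun h _ => ?_)
  rw [abs_mul]
  exact mul_le_mul (hx h) (hy _) (abs_nonneg _) ((abs_nonneg _).trans (hx h))

theorem abs_coeff_pow_le {x y : MonoidAlgebra ℝ G} (h : ∀ g, |x.coeff g| ≤ y.coeff g) (n : ℕ) :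
    ∀ g, |(x ^ n).coeff g| ≤ (y ^ n).coeff g := by
  induction n with
  | zero =>
    intro g
    simp only [pow_zero, MonoidAlgebra.one_def, MonoidAlgebra.coeff_single]
    rw [abs_of_nonneg]
    exact Finsupp.single_nonneg.2 zero_le_one g
  | succ n ih =>
    rw [pow_succ, pow_succ]
    exact abs_coeff_mul_le ih h

/-- The Neumann series `κ⁻¹ ∑ bⁿ` converges in `ℓᵖ`, and evaluation at a point is continuous, so
both convolution identities reduce to a telescoping sum at each coordinate. -/
theorem hasLpFormalInverse_of_summable {p : ℝ≥0∞} [Fact (1 ≤ p)] {f b : MonoidAlgebra ℝ G}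
    {κ : ℝ} (hκ : κ ≠ 0) (hf : f = κ • (1 - b)) (hb : Summable fun n : ℕ => ‖toLp p (b ^ n)‖) :
    HasLpFormalInverse p f := by
  have hs : Summable fun n : ℕ => toLp p (b ^ n) := hb.of_norm
  have hcoe : ∀ g, HasSum (fun n : ℕ => (b ^ n).coeff g) ((∑' n : ℕ, toLp p (b ^ n)) g) :=
    fun g => hs.hasSum.map (Pi.evalAddMonoidHom _ g |>.comp (lp.coeFnAddMonoidHom _ p))
      (lp.lipschitzWith_one_eval p g).continuous
  set η := ∑' n : ℕ, toLp p (b ^ n)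
  have htel : ∀ g, HasSum (fun n : ℕ => κ⁻¹ * (f * b ^ n).coeff g) (deltaOne g) := by
    intro g
    have h1 : ∀ n : ℕ, κ⁻¹ * (f * b ^ n).coeff g = (b ^ n).coeff g - (b ^ (n + 1)).coeff g := by
      intro n
      rw [hf, smul_mul_assoc, sub_mul, one_mul, ← pow_succ']
      simp [hκ]
    simp only [h1]
    have h0 : (b ^ 0).coeff g = deltaOne g := by
      classical
      simp [MonoidAlgebra.one_def, deltaOne, Finsupp.single_apply, eq_comm]
    have hsm := (hcoe g).summable
    have := hsm.hasSum.sub ((summable_nat_add_iff 1).2 hsm).hasSum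
    rwa [hsm.tsum_eq_zero_add, add_sub_cancel_right, h0] at this
  refine ⟨κ⁻¹ • ⇑η, (lp.memℓp η).const_smul κ⁻¹, ?_, ?_⟩ <;> funext g
  · refine HasSum.unique ?_ (htel g)
    -- Since `f` is a polynomial in `b`, the same telescoping series serves both sides.
    have hcomm : ∀ n : ℕ, f * b ^ n = b ^ n * f := fun n => by
      rw [hf, smul_mul_assoc, mul_smul_comm, sub_mul, mul_sub, one_mul, mul_one,
        ← pow_succ', ← pow_succ]
    simp only [hcomm, MonoidAlgebra.coeff_mul_apply_right, Finsupp.sum, Finset.mul_sum, convRight]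
    refine hasSum_sum fun h _ => ?_
    simp only [Pi.smul_apply, smul_eq_mul, ← mul_assoc]
    exact ((hcoe _).mul_left _).mul_right _
  · refine HasSum.unique ?_ (htel g)
    simp only [MonoidAlgebra.coeff_mul_apply_left, Finsupp.sum, Finset.mul_sum, convLeft]
    refine hasSum_sum fun h _ => ?_
    simp only [Pi.smul_apply, smul_eq_mul, mul_left_comm _ κ⁻¹]
    exact ((hcoe _).mul_left _).mul_left _

end GroupRing

/-! ### Displacement under left translation. -/

/-- The variance identity for a convex combination of vectors of equal norm. -/
theorem sum_mul_norm_sub_sq {ι V : Type*} [NormedAddCommGroup V] [InnerProductSpace ℝ V]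
    (s : Finset ι) (ν : ι → ℝ) (v : ι → V) (R : ℝ) (hν : ∑ i ∈ s, ν i = 1)
    (hv : ∀ i ∈ s, ‖v i‖ = R) :
    ∑ i ∈ s, ν i * ‖v i - ∑ j ∈ s, ν j • v j‖ ^ 2 = R ^ 2 - ‖∑ j ∈ s, ν j • v j‖ ^ 2 := by
  set m := ∑ j ∈ s, ν j • v j with hm
  have h1 : ∀ i ∈ s, ν i * ‖v i - m‖ ^ 2 =
      ν i * R ^ 2 - 2 * inner ℝ (ν i • v i) m + ν i * ‖m‖ ^ 2 := by
    intro i hi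
    rw [norm_sub_sq_real, hv i hi, real_inner_smul_left]
    ring
  rw [Finset.sum_congr rfl h1, Finset.sum_add_distrib, Finset.sum_sub_distrib, ← Finset.sum_mul,
    ← Finset.sum_mul, ← Finset.mul_sum, ← sum_inner, ← hm, hν, real_inner_self_eq_norm_sq]
  ring

namespace GroupRing

variable {G : Type*} [Group G]

/-- The `ℓ²` distance between an element of the group ring and its left translate by `h`. -/
noncomputable def translationDist (x : MonoidAlgebra ℝ G) (h : G) : ℝ :=
  ‖toLp 2 (MonoidAlgebra.single h 1 * x) - toLp 2 x‖

theorem translationDist_one (x : MonoidAlgebra ℝ G) : translationDist x 1 = 0 := by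
  rw [translationDist, ← MonoidAlgebra.one_def, one_mul, sub_self, norm_zero]

theorem translationDist_mul_le (x : MonoidAlgebra ℝ G) (h k : G) :
    translationDist x (h * k) ≤ translationDist x h + translationDist x k := by
  have h1 : translationDist x k = ‖toLp 2 (MonoidAlgebra.single (h * k) 1 * x) -
      toLp 2 (MonoidAlgebra.single h 1 * x)‖ := by
    rw [translationDist, ← map_sub, ← norm_toLp_single_mul (by simp) h, mul_sub, ← mul_assoc,
      MonoidAlgebra.single_mul_single, one_mul, map_sub]
  rw [h1, add_comm]
  exact norm_sub_le_norm_sub_add_norm_sub _ _ _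

theorem translationDist_inv (x : MonoidAlgebra ℝ G) (h : G) :
    translationDist x h⁻¹ = translationDist x h := by
  rw [translationDist, ← map_sub, ← norm_toLp_single_mul (by simp) h, mul_sub, ← mul_assoc,
    MonoidAlgebra.single_mul_single, mul_inv_cancel, one_mul, ← MonoidAlgebra.one_def, one_mul,
    map_sub, norm_sub_rev, translationDist]

/-- Displacement is subadditive and inversion invariant, so `L` can be the length of a word for `h`
in `S`; it does not depend on `x`. -/
theorem exists_translationDist_le_of_mem_closure {S : Set G} {h : G}
    (hh : h ∈ Subgroup.closure S) :
    ∃ L : ℝ, 0 ≤ L ∧ ∀ (x : MonoidAlgebra ℝ G) (M : ℝ), 0 ≤ M →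
      (∀ s ∈ S, translationDist x s ≤ M) → translationDist x h ≤ L * M := by
  induction hh using Subgroup.closure_induction with
  | mem s hs => exact ⟨1, zero_le_one, fun x M _ hM => by simpa using hM s hs⟩
  | one => exact ⟨0, le_rfl, fun x M _ _ => by simp [translationDist_one]⟩
  | mul h k _ _ ihh ihk =>
    obtain ⟨L₁, h₁, H₁⟩ := ihh
    obtain ⟨L₂, h₂, H₂⟩ := ihk
    refine ⟨L₁ + L₂, add_nonneg h₁ h₂, fun x M h0 hM => ?_⟩
    rw [add_mul]
    exact (translationDist_mul_le x h k).trans (add_le_add (H₁ x M h0 hM) (H₂ x M h0 hM))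
  | inv h _ ih =>
    obtain ⟨L, h₁, H⟩ := ih
    exact ⟨L, h₁, fun x M h0 hM => by rw [translationDist_inv]; exact H x M h0 hM⟩

theorem translationDist_le_of_mem_pow {T : Set G} {x : MonoidAlgebra ℝ G} {M : ℝ} (hM : 0 ≤ M)
    (hT : ∀ t ∈ T, translationDist x t ≤ M) (n : ℕ) {h : G}
    (hh : h ∈ (insert 1 (T ∪ T⁻¹) : Set G) ^ n) : translationDist x h ≤ n * M := by
  induction n generalizing h with
  | zero =>
    rw [pow_zero, Set.mem_one] at hh
    simp [hh, translationDist_one]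
  | succ n ih =>
    rw [pow_succ, Set.mem_mul] at hh
    obtain ⟨a, ha, t, ht, rfl⟩ := hh
    have h1 : translationDist x t ≤ M := by
      rcases ht with rfl | ht | ht
      · rwa [translationDist_one]
      · exact hT t ht
      · rw [← translationDist_inv]; exact hT _ ht
    have := (translationDist_mul_le x a t).trans (add_le_add (ih ha) h1)
    push_cast
    linarith

/-- Averaging over a finite set `B` compares the `ℓ²` norm with translation distances and the
`ℓ¹` norm. -/
theorem norm_toLp_two_le_of_translationDist_le {x : MonoidAlgebra ℝ G} (hx : absSum x ≤ 1)
    {B : Finset G} (hB : B.Nonempty) {M : ℝ} (hM : ∀ h ∈ B, translationDist x h ≤ M) :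
    ‖toLp 2 x‖ ≤ M + √(1 / (B.card : ℝ)) := by
  have hV : (0 : ℝ) < B.card := by exact_mod_cast hB.card_pos
  set V : ℝ := (B.card : ℝ) with hVdef
  set β : MonoidAlgebra ℝ G := ∑ h ∈ B, MonoidAlgebra.single h 1 with hβ
  set y : MonoidAlgebra ℝ G := V⁻¹ • (β * x) with hy
  have hy' : y = V⁻¹ • ∑ h ∈ B, MonoidAlgebra.single h 1 * x := by rw [hy, hβ, Finset.sum_mul]
  have h1 : ‖toLp 2 y - toLp 2 x‖ ≤ M := by
    have : toLp 2 y - toLp 2 x =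
        V⁻¹ • ∑ h ∈ B, (toLp 2 (MonoidAlgebra.single h 1 * x) - toLp 2 x) := by
      rw [hy', map_smul, map_sum, Finset.sum_sub_distrib, Finset.sum_const, smul_sub,
        ← Nat.cast_smul_eq_nsmul ℝ, ← hVdef, smul_smul, inv_mul_cancel₀ hV.ne', one_smul]
    rw [this, norm_smul, Real.norm_eq_abs, abs_of_pos (inv_pos.2 hV), inv_mul_le_iff₀ hV]
    refine (norm_sum_le _ _).trans ((Finset.sum_le_sum hM).trans ?_)
    rw [Finset.sum_const, nsmul_eq_mul]
  -- Each coefficient of the average `y` is `V⁻¹` times a sum of values of `x` at distinct points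
  -- `h⁻¹ * g`, hence is controlled by the `ℓ¹` norm of `x`.
  have hcoeff : ∀ g, |y.coeff g| ≤ V⁻¹ := by
    intro g
    rw [hy', MonoidAlgebra.coeff_smul_apply, MonoidAlgebra.coeff_sum, Finsupp.finsetSum_apply,
      smul_eq_mul, abs_mul, abs_of_pos (inv_pos.2 hV)]
    refine mul_le_of_le_one_right (inv_pos.2 hV).le ((Finset.abs_sum_le_sum_abs _ _).trans ?_)
    simp only [MonoidAlgebra.coeff_single_mul_apply, one_mul]
    have hinj : Function.Injective fun h : G => h⁻¹ * g := fun a b hab => by simpa using hab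
    refine le_trans (le_of_eq ?_) ((sum_abs_le_absSum x (B.map ⟨_, hinj⟩)).trans hx)
    rw [Finset.sum_map]
    rfl
  have habs : absSum y ≤ 1 := by
    rw [← norm_toLp_one, hy', map_smul, norm_smul, Real.norm_eq_abs, abs_of_pos (inv_pos.2 hV),
      inv_mul_le_iff₀ hV, mul_one, map_sum]
    refine (norm_sum_le _ _).trans ((Finset.sum_le_card_nsmul B _ 1 fun h _ => ?_).trans ?_)
    · rwa [norm_toLp_single_mul (by simp), norm_toLp_one]
    · simp [hVdef]
  have h2 : ‖toLp 2 y‖ ≤ √(1 / V) := by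
    refine Real.le_sqrt_of_sq_le ((norm_toLp_two_sq_le hcoeff).trans ?_)
    rw [one_div]
    exact mul_le_of_le_one_right (inv_pos.2 hV).le habs
  have h3 := norm_sub_norm_le (toLp 2 x) (toLp 2 y)
  rw [norm_sub_rev] at h3
  linarith

/-- The decrease of the `ℓ²` norm under a lazy averaging operator controls the translation
distances along its support. -/
theorem translationDist_sq_le {ν x : MonoidAlgebra ℝ G} (hν : ∀ g, 0 ≤ ν.coeff g)
    (hsum : absSum ν = 1) {c : ℝ} (hc : 0 < c) (h1 : c ≤ ν.coeff 1) {s : G}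
    (hs : c ≤ ν.coeff s) (hs1 : s ≠ 1) :
    translationDist x s ^ 2 ≤ 2 / c * (‖toLp 2 x‖ ^ 2 - ‖toLp 2 (ν * x)‖ ^ 2) := by
  classical
  have hvar := sum_mul_norm_sub_sq ν.coeff.support ν.coeff
    (fun h => toLp 2 (MonoidAlgebra.single h 1 * x)) ‖toLp 2 x‖
    (by rw [← hsum]; exact Finset.sum_congr rfl fun g _ => (abs_of_nonneg (hν g)).symm)
    (fun h _ => norm_toLp_single_mul (by simp) h x)
  have hm : ∑ j ∈ ν.coeff.support, ν.coeff j • toLp 2 (MonoidAlgebra.single j 1 * x) =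
      toLp 2 (ν * x) := by
    rw [mul_eq_sum_smul ν x, map_sum]
    simp only [map_smul]
  rw [hm] at hvar
  have hsub : ({1, s} : Finset G) ⊆ ν.coeff.support := by
    intro g hg
    simp only [Finset.mem_insert, Finset.mem_singleton] at hg
    rcases hg with rfl | rfl <;> simp only [Finsupp.mem_support_iff] <;> linarith
  -- Of the variance of the translates about their mean `ν * x`, only the terms at `1` and `s` are
  -- kept.
  have hle := Finset.sum_le_sum_of_subset_of_nonneg hsub
    (f := fun i => ν.coeff i * ‖toLp 2 (MonoidAlgebra.single i 1 * x) - toLp 2 (ν * x)‖ ^ 2)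
    fun i _ _ => mul_nonneg (hν i) (sq_nonneg _)
  rw [Finset.sum_pair hs1.symm, hvar, ← MonoidAlgebra.one_def, one_mul] at hle
  set p := ‖toLp 2 (MonoidAlgebra.single s 1 * x) - toLp 2 (ν * x)‖
  set q := ‖toLp 2 x - toLp 2 (ν * x)‖ with hq
  have htri : translationDist x s ≤ p + q := by
    rw [translationDist, hq, norm_sub_rev (toLp 2 x)]
    exact norm_sub_le_norm_sub_add_norm_sub _ _ _
  have h0 : 0 ≤ translationDist x s := norm_nonneg _
  have hpq : translationDist x s ^ 2 ≤ 2 * (p ^ 2 + q ^ 2) := by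
    nlinarith [sq_nonneg (p - q), pow_le_pow_left₀ h0 htri 2]
  have hcpq : c * (p ^ 2 + q ^ 2) ≤ ‖toLp 2 x‖ ^ 2 - ‖toLp 2 (ν * x)‖ ^ 2 := by
    nlinarith [mul_le_mul_of_nonneg_right h1 (sq_nonneg q),
      mul_le_mul_of_nonneg_right hs (sq_nonneg p)]
  calc translationDist x s ^ 2 ≤ 2 * (p ^ 2 + q ^ 2) := hpq
    _ = 2 / c * (c * (p ^ 2 + q ^ 2)) := by field_simp
    _ ≤ _ := mul_le_mul_of_nonneg_left hcpq (by positivity)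

end GroupRing

/-! ### Real inequalities for the decay. -/

theorem pow_ten_sub_pow_ten_le {z z' : ℝ} (h0 : 0 ≤ z') (h : z' ≤ z) :
    z ^ 10 - z' ^ 10 ≤ 10 * z ^ 9 * (z - z') := by
  have hz := h0.trans h
  have h1 : z ^ 10 - z' ^ 10 = (z - z') * ∑ i ∈ Finset.range 10, z ^ i * z' ^ (9 - i) :=
    ((Commute.all z z').mul_geom_sum₂ 10).symm
  have h2 : ∑ i ∈ Finset.range 10, z ^ i * z' ^ (9 - i) ≤ 10 * z ^ 9 := by
    refine (Finset.sum_le_card_nsmul _ _ (z ^ 9) fun i hi => ?_).trans (by simp)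
    have hi : i < 10 := Finset.mem_range.1 hi
    calc z ^ i * z' ^ (9 - i) ≤ z ^ i * z ^ (9 - i) :=
          mul_le_mul_of_nonneg_left (pow_le_pow_left₀ h0 h _) (pow_nonneg hz _)
      _ = z ^ 9 := by rw [← pow_add]; congr 1; omega
  rw [h1, mul_comm]
  exact mul_le_mul_of_nonneg_right h2 (sub_nonneg.2 h)

/-- One step of the decay: optimising the radius in a Nash type inequality of dimension five. -/
theorem le_mul_sub_of_forall_radius {L c K : ℝ} (hL : 0 ≤ L) (hc : 0 < c) (hK : 0 ≤ K)
    {z z' M : ℝ} (h0 : 0 ≤ z') (hz : z' ≤ z) (hz1 : z ≤ 1) (hM : 0 ≤ M)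
    (hr : ∀ r : ℕ, 1 ≤ r → z ^ 5 ≤ L * r * M + √(1 / (c * (r : ℝ) ^ 5)))
    (hD : M ^ 2 ≤ K * (z ^ 10 - z' ^ 10)) :
    z ^ 5 ≤ 160 * (max 1 (4 / c)) ^ 2 * L ^ 2 * K * (z - z') := by
  set A := max 1 (4 / c)
  have hA1 : 1 ≤ A := le_max_left _ _
  have hA4 : 4 / c ≤ A := le_max_right _ _
  rcases (h0.trans hz).eq_or_lt with hz0 | hz0
  · obtain rfl : z' = z := le_antisymm hz (hz0 ▸ h0)
    simp [← hz0]
  have hzsq : z ^ 2 ≤ 1 := pow_le_one₀ hz0.le hz1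
  have hz2 : 0 < z ^ 2 := pow_pos hz0 2
  have hAz : 1 ≤ A / z ^ 2 := by rw [le_div_iff₀ hz2]; linarith
  -- This radius makes the square root at most `z ^ 5 / 2`, because `A ^ 5 ≥ 4 / c`; as `A / z ^ 2 ≥
  -- 1`, rounding up costs at most a factor `2`.
  set r := ⌈A / z ^ 2⌉₊
  have hrA : A / z ^ 2 ≤ r := Nat.le_ceil _
  have hr2 : (r : ℝ) ≤ 2 * (A / z ^ 2) := by
    have := Nat.ceil_lt_add_one (zero_le_one.trans hAz)
    linarith
  have hr1 : 1 ≤ r := by exact_mod_cast hAz.trans hrA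
  have hsqrt : √(1 / (c * (r : ℝ) ^ 5)) ≤ z ^ 5 / 2 := by
    refine Real.sqrt_le_iff.2 ⟨by positivity, ?_⟩
    rw [div_le_iff₀ (by positivity)]
    have h5 : (A / z ^ 2) ^ 5 ≤ (r : ℝ) ^ 5 := pow_le_pow_left₀ (by positivity) hrA 5
    rw [div_pow, ← pow_mul, div_le_iff₀ (by positivity)] at h5
    have hA5 : 4 / c ≤ A ^ 5 := hA4.trans (le_self_pow₀ hA1 (by norm_num))
    rw [div_le_iff₀ hc] at hA5
    have h6 := mul_le_mul_of_nonneg_left h5 hc.le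
    calc (1 : ℝ) ≤ c * A ^ 5 / 4 := by linarith
      _ ≤ c * (r ^ 5 * z ^ (2 * 5)) / 4 := div_le_div_of_nonneg_right h6 (by norm_num)
      _ = _ := by ring
  have h1 := hr r hr1
  have h2 : z ^ 7 ≤ 4 * A * L * M := by
    have h3 : L * r * M ≤ L * (2 * (A / z ^ 2)) * M := by gcongr
    have h4 : z ^ 5 ≤ 4 * A * L * M / z ^ 2 := by
      calc z ^ 5 ≤ 2 * (L * (2 * (A / z ^ 2)) * M) := by linarith
        _ = _ := by ring
    rw [le_div_iff₀ hz2] at h4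
    linarith [h4, show z ^ 7 = z ^ 5 * z ^ 2 by ring]
  have h3 : z ^ 14 ≤ 16 * A ^ 2 * L ^ 2 * M ^ 2 := by
    have := pow_le_pow_left₀ (by positivity) h2 2
    linarith [this, show (z ^ 7) ^ 2 = z ^ 14 by ring,
      show (4 * A * L * M) ^ 2 = 16 * A ^ 2 * L ^ 2 * M ^ 2 by ring]
  -- `160 = 16 * 10`: the square of `4`, times the factor from `pow_ten_sub_pow_ten_le`.
  have h4 : z ^ 9 * z ^ 5 ≤ z ^ 9 * (160 * A ^ 2 * L ^ 2 * K * (z - z')) := by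
    calc z ^ 9 * z ^ 5 = z ^ 14 := by ring
      _ ≤ 16 * A ^ 2 * L ^ 2 * M ^ 2 := h3
      _ ≤ 16 * A ^ 2 * L ^ 2 * (K * (10 * z ^ 9 * (z - z'))) := by
        gcongr
        exact hD.trans (mul_le_mul_of_nonneg_left (pow_ten_sub_pow_ten_le h0 hz) hK)
      _ = _ := by ring
  exact le_of_mul_le_mul_left h4 (by positivity)

theorem summable_of_le_mul_sub {w z : ℕ → ℝ} {C : ℝ} (hC : 0 ≤ C) (hw : ∀ n, 0 ≤ w n)
    (hz : ∀ n, 0 ≤ z n) (h : ∀ n, w n ≤ C * (z n - z (n + 1))) : Summable w := by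
  refine summable_of_sum_range_le (c := C * z 0) hw fun n => ?_
  refine (Finset.sum_le_sum fun i _ => h i).trans ?_
  rw [← Finset.mul_sum, Finset.sum_range_sub']
  exact mul_le_mul_of_nonneg_left (by linarith [hz n]) hC

/-! ### Lower bounds on growth. -/

namespace GroupGrowth

theorem finite_ball {H : Type*} [Group H] {T : Set H} (hT : T.Finite) (n : ℕ) :
    ((insert 1 (T ∪ T⁻¹) : Set H) ^ n).Finite := by
  induction n with
  | zero => rw [pow_zero]; exact Set.finite_one
  | succ n ih => rw [pow_succ]; exact ih.mul ((hT.union hT.inv).insert 1)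

theorem one_le_growth {H : Type*} [Group H] {T : Set H} (hT : T.Finite) (n : ℕ) :
    1 ≤ growth T n :=
  (Set.ncard_pos (finite_ball hT n)).2 ⟨1, Set.one_mem_pow (Set.mem_insert _ _)⟩

/-- Superpolynomial growth, or polynomial growth of degree at least `k`, gives a lower bound of
degree `k` on the growth function. -/
theorem exists_mul_pow_le_growth {H : Type*} [Group H] (k : ℕ)
    (h : HasSuperpolynomialGrowth H ∨ ∃ d : ℕ, k ≤ d ∧ HasPolynomialGrowthOfDegree H d) :
    ∃ T : Set H, T.Finite ∧ ∃ c : ℝ, 0 < c ∧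
      ∀ n : ℕ, 1 ≤ n → c * (n : ℝ) ^ k ≤ (growth T n : ℝ) := by
  rcases h with ⟨T, hT, -, h⟩ | ⟨d, hd, T, hT, -, c, _, hc, -, h⟩
  · obtain ⟨N, hN⟩ := Filter.eventually_atTop.1 ((h k).eventually_ge_atTop 1)
    -- The constant is small enough for the trivial bound `1 ≤ growth T n` to suffice when `n ≤ N`.
    refine ⟨T, hT, 1 / ((N : ℝ) + 1) ^ k, by positivity, fun n hn => ?_⟩
    have hn0 : (0 : ℝ) < n := by exact_mod_cast hn
    rcases le_total N n with hNn | hNn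
    · have h1 := hN n hNn
      rw [le_div_iff₀ (by positivity), one_mul] at h1
      refine le_trans (mul_le_of_le_one_left (by positivity) ?_) h1
      rw [div_le_one (by positivity)]
      exact one_le_pow₀ (by linarith [Nat.cast_nonneg (α := ℝ) N])
    · have h1 : (1 : ℝ) ≤ growth T n := by exact_mod_cast one_le_growth hT n
      refine le_trans ?_ h1
      rw [one_div_mul_eq_div, div_le_one (by positivity)]
      have : (n : ℝ) ≤ N := by exact_mod_cast hNn
      gcongr
      linarith
  · refine ⟨T, hT, c, hc, fun n hn => le_trans ?_ (h n hn).1⟩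
    have : (1 : ℝ) ≤ n := by exact_mod_cast hn
    gcongr

end GroupGrowth

/-! ### Nash type inequality and summability of `‖νⁿ‖₂`. -/

namespace GroupRing

variable {G : Type*} [Group G]

/-- A Nash type inequality from a lower bound on the growth of a subgroup. -/
theorem exists_norm_toLp_two_le {S : Set G} {T : Set (Subgroup.closure S)} (hT : T.Finite) {c : ℝ}
    (hc : 0 < c) {k : ℕ}
    (hgrowth : ∀ n : ℕ, 1 ≤ n → c * (n : ℝ) ^ k ≤ (GroupGrowth.growth T n : ℝ)) :
    ∃ L : ℝ, 0 ≤ L ∧ ∀ (x : MonoidAlgebra ℝ G) (M : ℝ), absSum x ≤ 1 → 0 ≤ M →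
      (∀ s ∈ S, translationDist x s ≤ M) →
      ∀ r : ℕ, 1 ≤ r → ‖toLp 2 x‖ ≤ L * r * M + √(1 / (c * (r : ℝ) ^ k)) := by
  classical
  choose L₀ hL₀ H using fun h : Subgroup.closure S =>
    exists_translationDist_le_of_mem_closure h.2
  set L : ℝ := ∑ t ∈ hT.toFinset, L₀ t
  refine ⟨L, Finset.sum_nonneg fun t _ => hL₀ t, fun x M hx hM hS r hr => ?_⟩
  have hL : 0 ≤ L := Finset.sum_nonneg fun t _ => hL₀ t
  have hTM : ∀ t ∈ (Subtype.val '' T : Set G), translationDist x t ≤ L * M := by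
    rintro _ ⟨t, ht, rfl⟩
    refine (H t x M hM hS).trans (mul_le_mul_of_nonneg_right ?_ hM)
    exact Finset.single_le_sum (f := L₀) (fun t _ => hL₀ t) (hT.mem_toFinset.2 ht)
  have hfin := GroupGrowth.finite_ball hT r
  set B : Finset G := hfin.toFinset.map ⟨Subtype.val, Subtype.val_injective⟩ with hB
  have hcard : (B.card : ℝ) = GroupGrowth.growth T r := by
    rw [hB, Finset.card_map, GroupGrowth.growth, Set.ncard_eq_toFinset_card _ hfin]
  have hr0 : (0 : ℝ) < r := by exact_mod_cast hr
  have hlow := hgrowth r hr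
  rw [← hcard] at hlow
  have hpos : 0 < c * (r : ℝ) ^ k := by positivity
  have hne : B.Nonempty := by
    rw [← Finset.card_pos]
    exact_mod_cast hpos.trans_le hlow
  have hBM : ∀ h ∈ B, translationDist x h ≤ L * r * M := by
    intro h hh
    simp only [hB, Finset.mem_map, Set.Finite.mem_toFinset, Function.Embedding.coeFn_mk] at hh
    obtain ⟨a, ha, rfl⟩ := hh
    -- Balls are counted in the subgroup, but displacement is measured in `G`; the inclusion carries
    -- balls to balls.
    have himg : (Subtype.val '' ((insert 1 (T ∪ T⁻¹) : Set (Subgroup.closure S)) ^ r) : Set G) =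
        (insert 1 ((Subtype.val '' T) ∪ (Subtype.val '' T)⁻¹)) ^ r := by
      have := Set.image_pow (Subgroup.closure S).subtype
        (insert 1 (T ∪ T⁻¹) : Set (Subgroup.closure S)) r
      rw [Set.image_insert_eq, Set.image_union, Set.image_inv, map_one] at this
      exact this
    have hmem := himg ▸ Set.mem_image_of_mem Subtype.val ha
    have := translationDist_le_of_mem_pow (mul_nonneg hL hM) hTM r hmem
    linarith
  refine (norm_toLp_two_le_of_translationDist_le hx hne hBM).trans ?_
  gcongr

theorem summable_norm_toLp_two_pow {ν : MonoidAlgebra ℝ G} (hν : ∀ g, 0 ≤ ν.coeff g)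
    (hsum : absSum ν = 1) (h1 : 0 < ν.coeff 1)
    (hgrowth : GroupGrowth.HasSuperpolynomialGrowth (Subgroup.closure (offSupport ν)) ∨
      ∃ d : ℕ, 5 ≤ d ∧
        GroupGrowth.HasPolynomialGrowthOfDegree (Subgroup.closure (offSupport ν)) d) :
    Summable fun n : ℕ => ‖toLp 2 (ν ^ n)‖ := by
  obtain ⟨T, hT, c, hc, hg⟩ := GroupGrowth.exists_mul_pow_le_growth 5 hgrowth
  obtain ⟨L, hL, hnash⟩ := exists_norm_toLp_two_le hT hc hg
  have hone : (1 : G) ∈ ν.coeff.support := Finsupp.mem_support_iff.2 h1.ne'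
  -- The least positive coefficient is a common lower bound for the weights at `1` and at every
  -- generator.
  obtain ⟨m, hm, hmin⟩ := ν.coeff.support.exists_min_image ν.coeff ⟨1, hone⟩
  have ha : 0 < ν.coeff m := (hν m).lt_of_ne (Finsupp.mem_support_iff.1 hm).symm
  set w : ℕ → ℝ := fun n => ‖toLp 2 (ν ^ n)‖
  have hw0 : ∀ n, 0 ≤ w n := fun n => norm_nonneg _
  have hstep : ∀ n, w (n + 1) ≤ w n := fun n => by
    have := norm_toLp_mul_le (p := 2) (by simp) ν (ν ^ n)
    rwa [hsum, one_mul, ← pow_succ'] at this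
  have habs : ∀ n, absSum (ν ^ n) ≤ 1 := fun n => by
    simpa [hsum] using absSum_pow_le ν n
  have hw1 : ∀ n, w n ≤ 1 := fun n => by
    have := norm_toLp_two_sq_le (x := ν ^ n) (C := 1) fun g => by
      simpa using (sum_abs_le_absSum (ν ^ n) {g}).trans (habs n)
    have h2 : w n ^ 2 ≤ 1 := this.trans (by simpa using habs n)
    exact (sq_le_one_iff₀ (hw0 n)).1 h2
  set z : ℕ → ℝ := fun n => w n ^ (5⁻¹ : ℝ)
  have hz0 : ∀ n, 0 ≤ z n := fun n => Real.rpow_nonneg (hw0 n) _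
  have hz5 : ∀ n, z n ^ 5 = w n := fun n => by
    have := Real.rpow_inv_natCast_pow (hw0 n) (n := 5) (by norm_num)
    exact_mod_cast this
  have hz10 : ∀ n, z n ^ 10 = w n ^ 2 := fun n => by rw [← hz5]; ring
  refine summable_of_le_mul_sub (C := 160 * (max 1 (4 / c)) ^ 2 * L ^ 2 * (2 / ν.coeff m))
    (by positivity) hw0 hz0 fun n => ?_
  have hD : 0 ≤ 2 / ν.coeff m * (w n ^ 2 - w (n + 1) ^ 2) :=
    mul_nonneg (by positivity) (sub_nonneg.2 (pow_le_pow_left₀ (hw0 _) (hstep n) 2))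
  rw [← hz5]
  refine le_mul_sub_of_forall_radius hL hc (by positivity) (hz0 _)
    (Real.rpow_le_rpow (hw0 _) (hstep n) (by norm_num))
    (Real.rpow_le_one (hw0 _) (hw1 n) (by norm_num))
    (M := √(2 / ν.coeff m * (w n ^ 2 - w (n + 1) ^ 2))) (Real.sqrt_nonneg _) ?_ ?_
  · rw [hz5]
    refine hnash (ν ^ n) _ (habs n) (Real.sqrt_nonneg _) fun s hs => ?_
    refine Real.le_sqrt_of_sq_le ?_
    have := translationDist_sq_le (x := ν ^ n) hν hsum ha (hmin 1 hone)
      (hmin s (Finsupp.mem_support_iff.2 hs.1)) hs.2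
    rwa [← pow_succ'] at this
  · rw [Real.sq_sqrt hD, hz10, hz10]

end GroupRing

/-! ### Reduction of `f` to a lazy probability measure. -/

namespace GroupRing

variable {G : Type*}

/-- The element whose coefficients are the absolute values of those of `x`. -/
noncomputable def absCoeff (x : MonoidAlgebra ℝ G) : MonoidAlgebra ℝ G :=
  .ofCoeff (x.coeff.mapRange abs abs_zero)

theorem coeff_absCoeff (x : MonoidAlgebra ℝ G) (g : G) : (absCoeff x).coeff g = |x.coeff g| := rfl

theorem absSum_absCoeff (x : MonoidAlgebra ℝ G) : absSum (absCoeff x) = absSum x := by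
  have hsupp : (absCoeff x).coeff.support = x.coeff.support := by
    ext g
    simp [coeff_absCoeff]
  simp [absSum, hsupp, coeff_absCoeff]

variable [Group G]

theorem absSum_eq_add_offNorm (x : MonoidAlgebra ℝ G) : absSum x = |x.coeff 1| + offNorm x := by
  classical
  rw [offNorm, absSum]
  by_cases h : (1 : G) ∈ x.coeff.support
  · rw [← Finset.add_sum_erase _ _ h]
  · rw [Finsupp.notMem_support_iff.1 h, abs_zero, zero_add]
    exact Finset.sum_congr (Finset.erase_eq_of_notMem h).symm fun _ _ => rfl

/-- The element `b` with `f = 2 f₁ (1 - b)`. -/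
noncomputable def lazyPart (f : MonoidAlgebra ℝ G) : MonoidAlgebra ℝ G := 1 - (2 * f.coeff 1)⁻¹ • f

theorem eq_smul_one_sub_lazyPart {f : MonoidAlgebra ℝ G} (hf : 0 < f.coeff 1) :
    f = (2 * f.coeff 1) • (1 - lazyPart f) := by
  rw [lazyPart, sub_sub_cancel, smul_smul, mul_inv_cancel₀ (by positivity), one_smul]

theorem coeff_one_lazyPart {f : MonoidAlgebra ℝ G} (hf : 0 < f.coeff 1) :
    (lazyPart f).coeff 1 = 1 / 2 := by
  simp only [lazyPart, MonoidAlgebra.coeff_sub, Finsupp.sub_apply, MonoidAlgebra.coeff_one_one,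
    MonoidAlgebra.coeff_smul_apply, smul_eq_mul]
  field_simp
  norm_num

theorem coeff_lazyPart_of_ne_one (f : MonoidAlgebra ℝ G) {g : G} (hg : g ≠ 1) :
    (lazyPart f).coeff g = -((2 * f.coeff 1)⁻¹ * f.coeff g) := by
  simp [lazyPart, MonoidAlgebra.one_def, hg]

theorem coeff_lazyPart_ne_zero_iff {f : MonoidAlgebra ℝ G} (hf : 0 < f.coeff 1) (g : G) :
    (lazyPart f).coeff g ≠ 0 ↔ f.coeff g ≠ 0 := by
  by_cases hg : g = 1
  · subst hg
    simp [coeff_one_lazyPart hf, hf.ne']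
  · simp [coeff_lazyPart_of_ne_one f hg, hf.ne']

theorem absSum_lazyPart {f : MonoidAlgebra ℝ G} (hf : 0 < f.coeff 1) :
    absSum (lazyPart f) = 1 / 2 + (2 * f.coeff 1)⁻¹ * offNorm f := by
  classical
  have hsupp : (lazyPart f).coeff.support = f.coeff.support := by
    ext g
    simpa using coeff_lazyPart_ne_zero_iff hf g
  rw [absSum_eq_add_offNorm, coeff_one_lazyPart hf, abs_of_pos (by norm_num), offNorm, offNorm,
    Finset.mul_sum, hsupp]
  congr 1
  refine Finset.sum_congr rfl fun g hg => ?_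
  rw [coeff_lazyPart_of_ne_one f (Finset.ne_of_mem_erase hg), abs_neg, abs_mul,
    abs_of_pos (a := (2 * f.coeff 1)⁻¹) (by positivity)]

theorem hasLpFormalInverse_one_of_isLopsided {f : MonoidAlgebra ℝ G} (hf : 0 < f.coeff 1)
    (hlop : IsLopsided f) : HasLpFormalInverse 1 f := by
  refine hasLpFormalInverse_of_summable (by positivity) (eq_smul_one_sub_lazyPart hf) ?_
  simp only [norm_toLp_one]
  refine Summable.of_nonneg_of_le (fun _ => absSum_nonneg _) (absSum_pow_le _)
    (summable_geometric_of_lt_one (absSum_nonneg _) ?_)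
  rw [absSum_lazyPart hf]
  have : (2 * f.coeff 1)⁻¹ * offNorm f < 1 / 2 := by
    rw [inv_mul_lt_iff₀ (by positivity)]
    linarith [show offNorm f < f.coeff 1 from hlop]
  linarith

theorem hasLpFormalInverse_two {f : MonoidAlgebra ℝ G} (hf : IsSemiLopsided f)
    (hlop : ¬ IsLopsided f)
    (hgrowth : GroupGrowth.HasSuperpolynomialGrowth (Subgroup.closure (offSupport f)) ∨
      ∃ d : ℕ, 5 ≤ d ∧
        GroupGrowth.HasPolynomialGrowthOfDegree (Subgroup.closure (offSupport f)) d) :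
    HasLpFormalInverse 2 f := by
  obtain ⟨hpos, hle⟩ := hf
  have heq : offNorm f = f.coeff 1 := le_antisymm hle (not_lt.1 hlop)
  have hS : offSupport (absCoeff (lazyPart f)) = offSupport f := by
    ext g
    simp only [offSupport, Set.mem_ofPred_eq, coeff_absCoeff, abs_ne_zero,
      coeff_lazyPart_ne_zero_iff hpos]
  -- Semi-lopsided but not lopsided means equality, so the total mass is `1/2 + 1/2`.
  have hsum : absSum (absCoeff (lazyPart f)) = 1 := by
    rw [absSum_absCoeff, absSum_lazyPart hpos, heq]
    field_simp
    norm_num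
  have hsm := summable_norm_toLp_two_pow (fun g => abs_nonneg _) hsum
    (by rw [coeff_absCoeff, coeff_one_lazyPart hpos]; norm_num) (by rwa [hS])
  refine hasLpFormalInverse_of_summable (by positivity) (eq_smul_one_sub_lazyPart hpos) ?_
  exact hsm.of_nonneg_of_le (fun _ => norm_nonneg _)
    fun n => norm_toLp_mono (abs_coeff_pow_le (fun g => (coeff_absCoeff _ g).ge) n)

end GroupRing

theorem corollaryC {G : Type*} [Group G] [Countable G] (f : MonoidAlgebra ℝ G)
    (hf : GroupRing.IsSemiLopsided f)
    (hinf : Infinite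
      (Subgroup.closure ((GroupRing.offSupport f ∪ (GroupRing.offSupport f)⁻¹) ^ 2))) :
    (GroupRing.IsLopsided f → GroupRing.HasLpFormalInverse 1 f) ∧
    (¬ GroupRing.IsLopsided f →
      (GroupGrowth.HasSuperpolynomialGrowth (Subgroup.closure (GroupRing.offSupport f)) ∨
        ∃ d : ℕ, 5 ≤ d ∧
          GroupGrowth.HasPolynomialGrowthOfDegree
            (Subgroup.closure (GroupRing.offSupport f)) d) →
      GroupRing.HasLpFormalInverse 2 f) :=
  ⟨GroupRing.hasLpFormalInverse_one_of_isLopsided hf.1, GroupRing.hasLpFormalInverse_two hf⟩
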